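/- Consider an $N_1\times N_2$ input-queued crossbar switch in discrete time $s=0,1,2,\dots$, empty at time $0$. Let $q_{ij}(s)$ be the number of packets waiting at input $i$ for output $j$ at the start of slot $s$. The total queue (weight) of a port is $q_i(s)=\sum_j q_{ij}(s)$ for an input port $i$ and $q_j(s)=\sum_i q_{ij}(s)$ for an output port $j$. Let $G(s)$ be the bipartite graph of input and output ports in which $(i,j)$ is an edge if and only if $q_{ij}(s)\ge 1$. In slot $s$ a scheduling policy picks a matching $M(s)$ of $G(s)$ (not necessarily maximal); one packet is transferred along each edge of $M(s)$ and leaves the system; then the packets arriving in slot $s$ (any number, at any inputs and for any outputs) join the queues. For an input or output port $p$ let $a_p(n)$ and $d_p(n)$ be the numbers of packets that have arrived at, respectively departed from, port $p$ in the first $n$ slots (for an output port: packets destined for, respectively transferred to, that port). The threshold of a matching $M$ of $G(s)$ is the least positive integer $l$ such that $M$ matches every port $p$, input or output, with $q_p(s)\ge l$. The matching is LHPF (lazy heaviest port first) if its threshold is lowest among all matchings of $G(s)$. An LHPF policy is one for which $M(s)$ is an LHPF matching of $G(s)$ in every slot $s$; ties may be broken in any way, possibly depending on the past and on additional randomness.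 Theorem. Suppose that there are real numbers $\lambda_p<1$ such that, with probability one, $\lim_{n\to\infty} a_p(n)/n=\lambda_p$ for every input and output port $p$. Then every LHPF policy is rate stable: with probability one, $\lim_{n\to\infty} d_p(n)/n=\lambda_p$ for every input and output port $p$ (equivalently, since $q_p(n)=a_p(n)-d_p(n)$, $\lim_{n\to\infty} q_p(n)/n=0$ for every port $p$). That is, any LHPF policy is throughput optimal. -/

import Mathlib

open Filter Topology MeasureTheory

/-- The ports of an `N₁ × N₂` switch: the input ports `Sum.inl i` and the output ports
`Sum.inr j`. -/
abbrev Port (N₁ N₂ : ℕ) : Type := Fin N₁ ⊕ Fin N₂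

/-- Packet counts of an `N₁ × N₂` switch: the entry `i j` counts packets at input `i` that are
destined for output `j`. -/
abbrev Packets (N₁ N₂ : ℕ) : Type := Fin N₁ → Fin N₂ → ℕ

/-- The number of the counted packets that belong to a port: the row sum for an input port, the
column sum for an output port. For the queues `q` this is the weight of the port. -/
def portTotal {N₁ N₂ : ℕ} (q : Packets N₁ N₂) : Port N₁ N₂ → ℕ
  | Sum.inl i => ∑ j, q i j
  | Sum.inr j => ∑ i, q i j

/-- `M` is a matching (a set of pairwise disjoint edges) in the bipartite graph on the ports that
has an edge `(i, j)` if and only if there is at least one packet at input `i` destined for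
output `j`. -/
def IsSwitchMatching {N₁ N₂ : ℕ} (q : Packets N₁ N₂) (M : Finset (Fin N₁ × Fin N₂)) : Prop :=
  (∀ e ∈ M, 0 < q e.1 e.2) ∧
  (∀ e ∈ M, ∀ f ∈ M, e.1 = f.1 → e = f) ∧
  (∀ e ∈ M, ∀ f ∈ M, e.2 = f.2 → e = f)

/-- `M` matches a port if it contains some edge touching it. -/
def MatchesPort {N₁ N₂ : ℕ} (M : Finset (Fin N₁ × Fin N₂)) : Port N₁ N₂ → Prop
  | Sum.inl i => ∃ j, (i, j) ∈ M
  | Sum.inr j => ∃ i, (i, j) ∈ M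

/-- The threshold of `M`: the lowest positive integer `l` such that `M` matches all ports of
weight at least `l`. -/
noncomputable def threshold {N₁ N₂ : ℕ} (q : Packets N₁ N₂)
    (M : Finset (Fin N₁ × Fin N₂)) : ℕ :=
  sInf {l : ℕ | 0 < l ∧ ∀ p : Port N₁ N₂, l ≤ portTotal q p → MatchesPort M p}

/-- The set whose minimum defines the threshold is nonempty, so that the threshold is one of its
elements (and not a junk value). -/
theorem threshold_spec {N₁ N₂ : ℕ} (q : Packets N₁ N₂) (M : Finset (Fin N₁ × Fin N₂)) :
    0 < threshold q M ∧
      ∀ p : Port N₁ N₂, threshold q M ≤ portTotal q p → MatchesPort M p := by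
  have h : {l : ℕ | 0 < l ∧ ∀ p : Port N₁ N₂, l ≤ portTotal q p → MatchesPort M p}.Nonempty := by
    refine ⟨(∑ p, portTotal q p) + 1, Nat.succ_pos _, fun p hp => ?_⟩
    have := Finset.single_le_sum (f := portTotal q) (fun _ _ => Nat.zero_le _) (Finset.mem_univ p)
    omega
  exact Nat.sInf_mem h

/-- `M` is an LHPF (lazy heaviest port first) matching: a matching that has the lowest threshold
among all matchings. -/
def IsLHPFMatching {N₁ N₂ : ℕ} (q : Packets N₁ N₂) (M : Finset (Fin N₁ × Fin N₂)) : Prop :=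
  IsSwitchMatching q M ∧ ∀ M', IsSwitchMatching q M' → threshold q M ≤ threshold q M'

/-- A scheduling policy: a rule that picks the set of edges `π s ω q` to be served in slot `s`
when the queues at the start of the slot are `q`. The dependence on the sample point `ω` allows
for randomization, and for the use of the past and of any other information. -/
abbrev Policy (Ω : Type*) (N₁ N₂ : ℕ) : Type _ :=
  ℕ → Ω → Packets N₁ N₂ → Finset (Fin N₁ × Fin N₂)

/-- The packets transferred if the edges in `M` are served: one for each edge. -/
def transferred {N₁ N₂ : ℕ} (M : Finset (Fin N₁ × Fin N₂)) : Packets N₁ N₂ :=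
  fun i j => if (i, j) ∈ M then 1 else 0

/-- The queues at the start of slot `n = 0, 1, 2, …` under the policy `π`, where `A s ω i j` is the
number of packets that arrive at input `i` for output `j` in slot `s`. The system is empty at
time `0`. -/
def queue {Ω : Type*} {N₁ N₂ : ℕ} (A : ℕ → Ω → Packets N₁ N₂) (π : Policy Ω N₁ N₂) :
    ℕ → Ω → Packets N₁ N₂
  | 0, _ => fun _ _ => 0
  | n + 1, ω => fun i j =>
      queue A π n ω i j - transferred (π n ω (queue A π n ω)) i j + A n ω i j

/-- The matching scheduled in slot `n` under the policy `π`. -/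
def schedule {Ω : Type*} {N₁ N₂ : ℕ} (A : ℕ → Ω → Packets N₁ N₂) (π : Policy Ω N₁ N₂)
    (n : ℕ) (ω : Ω) : Finset (Fin N₁ × Fin N₂) :=
  π n ω (queue A π n ω)

/-- The cumulative number of packets that have arrived at (or for) port `p` in the first `n`
slots. -/
def arrivals {Ω : Type*} {N₁ N₂ : ℕ} (A : ℕ → Ω → Packets N₁ N₂) (p : Port N₁ N₂)
    (n : ℕ) (ω : Ω) : ℕ :=
  ∑ s ∈ Finset.range n, portTotal (A s ω) p

/-- The cumulative number of packets that have departed from (or to) port `p` in the first `n`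
slots. -/
def departures {Ω : Type*} {N₁ N₂ : ℕ} (A : ℕ → Ω → Packets N₁ N₂) (π : Policy Ω N₁ N₂)
    (p : Port N₁ N₂) (n : ℕ) (ω : Ω) : ℕ :=
  ∑ s ∈ Finset.range n, portTotal (transferred (schedule A π s ω)) p

/-- The arrivals satisfy a strong law of large numbers with rate `rate p` at every port `p`. -/
def SatisfiesSLLN {Ω : Type*} [MeasurableSpace Ω] {N₁ N₂ : ℕ} (P : Measure Ω)
    (A : ℕ → Ω → Packets N₁ N₂) (rate : Port N₁ N₂ → ℝ) : Prop :=
  ∀ᵐ ω ∂P, ∀ p, Tendsto (fun n : ℕ => (arrivals A p n ω : ℝ) / n) atTop (𝓝 (rate p))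

/-- An LHPF policy: in every slot it produces an LHPF matching. -/
def IsLHPFPolicy {Ω : Type*} {N₁ N₂ : ℕ} (A : ℕ → Ω → Packets N₁ N₂)
    (π : Policy Ω N₁ N₂) : Prop :=
  ∀ n ω, IsLHPFMatching (queue A π n ω) (schedule A π n ω)

/-- Rate stability: with probability one, packets depart at every port at the rate at which they
arrive there. -/
def RateStable {Ω : Type*} [MeasurableSpace Ω] {N₁ N₂ : ℕ} (P : Measure Ω)
    (A : ℕ → Ω → Packets N₁ N₂) (π : Policy Ω N₁ N₂) (rate : Port N₁ N₂ → ℝ) : Prop :=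
  ∀ᵐ ω ∂P, ∀ p, Tendsto (fun n : ℕ => (departures A π p n ω : ℝ) / n) atTop (𝓝 (rate p))

/-! The argument is pathwise. By Hall's theorem some matching covers every port whose weight is
within a fraction `1 / (N₁ + N₂)` of the maximum, so by minimality of the threshold an LHPF matching
does too (`IsLHPFMatching.matchesPort`). Hence a linearly long maximal queue is impossible
(`exists_le_mul_add_of_served`): queues move little over a window that is a small fraction of the
elapsed time, so the port with the longest queue at the end was near-maximal, and served, in every
slot of the window. Its arrival rate is below one, so its queue did not grow there, and strong
induction on time bounds it by `ε n + C`. -/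

/-! ### Matchings that cover the heavy ports -/

/-- **Hall's theorem for almost regular matrices.** If all column sums of a square matrix of natural
numbers are at most `D` and all row sums exceed `D - D / n`, where `n` is the size of the matrix,
then some transversal has only positive entries. -/
theorem exists_bijective_pos_of_sum_le {ι : Type*} [Fintype ι] [DecidableEq ι]
    (m : ι → ι → ℕ) (D : ℕ) (hcol : ∀ j, ∑ i, m i j ≤ D)
    (hrow : ∀ i, Fintype.card ι * D < Fintype.card ι * (∑ j, m i j) + D) :
    ∃ h : ι → ι, Function.Bijective h ∧ ∀ i, 0 < m i (h i) := by
  classical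
  have key := (Finset.all_card_le_biUnion_card_iff_exists_injective
    (fun i => Finset.univ.filter fun j => 0 < m i j)).1 ?_
  · obtain ⟨h, hinj, hpos⟩ := key
    exact ⟨h, Finite.injective_iff_bijective.1 hinj, fun i => by simpa using hpos i⟩
  intro s
  set T := s.biUnion fun i => Finset.univ.filter fun j => 0 < m i j with hT
  rcases s.eq_empty_or_nonempty with rfl | hs
  · simp
  -- The rows in `s` carry more than `|s| (D - D / n) ≥ (|s| - 1) D`, all of it in the columns `T`,
  -- which hold at most `|T| D`.
  by_contra! hlt
  have hrow_eq : ∀ i ∈ s, ∑ j, m i j = ∑ j ∈ T, m i j := fun i hi => by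
    refine (Finset.sum_subset (Finset.subset_univ _) fun j _ hj => ?_).symm
    by_contra hne
    exact hj (Finset.mem_biUnion.2 ⟨i, hi, by simpa using Nat.pos_of_ne_zero hne⟩)
  have hle : ∑ i ∈ s, ∑ j, m i j ≤ T.card * D := by
    rw [Finset.sum_congr rfl hrow_eq, Finset.sum_comm]
    refine (Finset.sum_le_card_nsmul T _ D fun j _ => ?_).trans_eq (smul_eq_mul _ _)
    exact (Finset.sum_le_sum_of_subset (Finset.subset_univ s)).trans (hcol j)
  have hsum : s.card * (Fintype.card ι * D) <
      Fintype.card ι * (∑ i ∈ s, ∑ j, m i j) + s.card * D := by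
    have := Finset.sum_lt_sum_of_nonempty hs fun i _ => hrow i
    simpa [Finset.sum_add_distrib, Finset.mul_sum] using this
  have hcard : s.card ≤ Fintype.card ι := Finset.card_le_univ s
  have h1 : Fintype.card ι * (∑ i ∈ s, ∑ j, m i j) ≤ Fintype.card ι * (T.card * D) :=
    Nat.mul_le_mul_left _ hle
  have h2 : Fintype.card ι * ((T.card + 1) * D) ≤ Fintype.card ι * (s.card * D) :=
    Nat.mul_le_mul_left _ (Nat.mul_le_mul_right _ hlt)
  have h3 : s.card * D ≤ Fintype.card ι * D := Nat.mul_le_mul_right _ hcard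
  nlinarith

/-- The symmetric matrix on the ports whose entry at an input and an output is the number of packets
queued between them. -/
def portWeight {N₁ N₂ : ℕ} (q : Packets N₁ N₂) : Port N₁ N₂ → Port N₁ N₂ → ℕ
  | Sum.inl i, Sum.inr j => q i j
  | Sum.inr j, Sum.inl i => q i j
  | _, _ => 0

theorem portWeight_comm {N₁ N₂ : ℕ} (q : Packets N₁ N₂) (p p' : Port N₁ N₂) :
    portWeight q p p' = portWeight q p' p := by
  rcases p with i | j <;> rcases p' with i' | j' <;> rfl

theorem sum_portWeight {N₁ N₂ : ℕ} (q : Packets N₁ N₂) (p : Port N₁ N₂) :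
    ∑ p', portWeight q p p' = portTotal q p := by
  rcases p with i | j <;> simp [portWeight, portTotal]

/-- If no port has weight above `D`, some matching covers all ports whose weight exceeds
`D - D / (N₁ + N₂)`. -/
theorem exists_matching_heavy_ports {N₁ N₂ : ℕ} (q : Packets N₁ N₂) (D : ℕ) (hD : 0 < D)
    (hq : ∀ p, portTotal q p ≤ D) :
    ∃ M, IsSwitchMatching q M ∧
      ∀ p, (N₁ + N₂) * D < (N₁ + N₂) * portTotal q p + D → MatchesPort M p := by
  classical
  set heavy : Port N₁ N₂ → Prop := fun p => (N₁ + N₂) * D < (N₁ + N₂) * portTotal q p + D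
    with hheavy
  -- Diagonal padding lifts light ports to row sum exactly `D`. Heavy ports meet Hall's bound
  -- without it, so a positive transversal cannot fix them.
  set m : Port N₁ N₂ → Port N₁ N₂ → ℕ := fun p p' =>
    portWeight q p p' + if p = p' then (if heavy p then 0 else D - portTotal q p) else 0 with hm
  have hrow : ∀ p, ∑ p', m p p' = portTotal q p + if heavy p then 0 else D - portTotal q p := by
    intro p
    simp only [hm, Finset.sum_add_distrib, sum_portWeight]
    simp
  have hsymm : ∀ p p', m p p' = m p' p := fun p p' => by
    simp only [hm, portWeight_comm q p p']
    by_cases h : p = p'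
    · rw [h]
    · rw [if_neg h, if_neg (Ne.symm h)]
  obtain ⟨h, hbij, hpos⟩ := exists_bijective_pos_of_sum_le m D
    (fun p => by
      simp only [hsymm _ p, hrow]
      have := hq p
      split_ifs <;> omega)
    (fun p => by
      rw [hrow]
      simp only [Fintype.card_sum, Fintype.card_fin]
      have := hq p
      split_ifs with hp
      · exact hp
      · rw [Nat.add_sub_cancel' this]
        omega)
  have hfix : ∀ p, h p = p → ¬ heavy p := fun p hp hh => by
    have := hpos p
    rw [hp] at this
    rcases p with i | j <;> simp [hm, portWeight, hh] at this
  have hinl : ∀ i i', h (Sum.inl i) = Sum.inl i' → i = i' := fun i i' he => by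
    by_contra hne
    have := hpos (Sum.inl i)
    simp [hm, he, portWeight, hne] at this
  have hinr : ∀ j j', h (Sum.inr j) = Sum.inr j' → j = j' := fun j j' he => by
    by_contra hne
    have := hpos (Sum.inr j)
    simp [hm, he, portWeight, hne] at this
  -- Keep only the arcs of the permutation from inputs to outputs: a heavy input has its image, and
  -- a heavy output its preimage, on the other side.
  refine ⟨Finset.univ.filter fun e => h (Sum.inl e.1) = Sum.inr e.2, ⟨?_, ?_, ?_⟩, ?_⟩
  · rintro ⟨i, j⟩ he
    have he : h (Sum.inl i) = Sum.inr j := by simpa using he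
    have := hpos (Sum.inl i)
    simpa [hm, he, portWeight] using this
  · rintro ⟨i, j⟩ he ⟨i', j'⟩ he' (rfl : i = i')
    simp only [Finset.mem_filter, Finset.mem_univ, true_and] at he he'
    rw [he] at he'
    simpa using he'
  · rintro ⟨i, j⟩ he ⟨i', j'⟩ he' (rfl : j = j')
    simp only [Finset.mem_filter, Finset.mem_univ, true_and] at he he'
    have := hbij.injective (he.trans he'.symm)
    simpa using this
  · rintro (i | j) hp
    · rcases he : h (Sum.inl i) with i' | j
      · obtain rfl := hinl i i' he
        exact absurd hp (hfix _ he)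
      · exact ⟨j, by simpa using he⟩
    · obtain ⟨i | j', he⟩ := hbij.surjective (Sum.inr j)
      · exact ⟨i, by simpa using he⟩
      · obtain rfl := hinr j' j he
        exact absurd hp (hfix _ he)

/-- An LHPF matching covers all ports whose weight is close enough to the maximal weight. -/
theorem IsLHPFMatching.matchesPort {N₁ N₂ : ℕ} {q : Packets N₁ N₂}
    {M : Finset (Fin N₁ × Fin N₂)} (hM : IsLHPFMatching q M) {D : ℕ}
    (hq : ∀ p, portTotal q p ≤ D) {p : Port N₁ N₂}
    (hp : (N₁ + N₂) * D < (N₁ + N₂) * portTotal q p + D) : MatchesPort M p := by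
  have hpD := hq p
  have hD : 0 < D := by
    by_contra h0
    have h1 : D = 0 := by omega
    have h2 : portTotal q p = 0 := by omega
    simp [h1, h2] at hp
  have hpos : 0 < portTotal q p := by
    by_contra h0
    have h2 : portTotal q p = 0 := by omega
    have hN : 0 < N₁ + N₂ := by
      rcases p with i | j
      · have := i.pos
        omega
      · have := j.pos
        omega
    rw [h2] at hp
    nlinarith
  obtain ⟨M', hM', hcover⟩ := exists_matching_heavy_ports q D hD hq
  have hle : threshold q M' ≤ portTotal q p := Nat.sInf_le ⟨hpos, fun p' hp' => hcover p' <| by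
    have := Nat.mul_le_mul_left (N₁ + N₂) hp'
    omega⟩
  exact (threshold_spec q M).2 p ((hM.2 M' hM').trans hle)

/-! ### Packet bookkeeping -/

theorem portTotal_add {N₁ N₂ : ℕ} (q q' : Packets N₁ N₂) (p : Port N₁ N₂) :
    portTotal (fun i j => q i j + q' i j) p = portTotal q p + portTotal q' p := by
  rcases p with i | j <;> simp [portTotal, Finset.sum_add_distrib]

theorem IsSwitchMatching.transferred_le {N₁ N₂ : ℕ} {q : Packets N₁ N₂}
    {M : Finset (Fin N₁ × Fin N₂)} (hM : IsSwitchMatching q M) (i : Fin N₁) (j : Fin N₂) :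
    transferred M i j ≤ q i j := by
  unfold transferred
  split_ifs with h
  · exact hM.1 _ h
  · exact Nat.zero_le _

theorem IsSwitchMatching.portTotal_transferred_le_one {N₁ N₂ : ℕ} {q : Packets N₁ N₂}
    {M : Finset (Fin N₁ × Fin N₂)} (hM : IsSwitchMatching q M) (p : Port N₁ N₂) :
    portTotal (transferred M) p ≤ 1 := by
  rcases p with i | j
  · simp only [portTotal, transferred, Finset.sum_boole, Nat.cast_id]
    refine Finset.card_le_one.2 fun j hj j' hj' => ?_
    simp only [Finset.mem_filter, Finset.mem_univ, true_and] at hj hj'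
    simpa using hM.2.1 _ hj _ hj' rfl
  · simp only [portTotal, transferred, Finset.sum_boole, Nat.cast_id]
    refine Finset.card_le_one.2 fun i hi i' hi' => ?_
    simp only [Finset.mem_filter, Finset.mem_univ, true_and] at hi hi'
    simpa using hM.2.2 _ hi _ hi' rfl

theorem MatchesPort.one_le_portTotal_transferred {N₁ N₂ : ℕ} {M : Finset (Fin N₁ × Fin N₂)}
    {p : Port N₁ N₂} (hp : MatchesPort M p) : 1 ≤ portTotal (transferred M) p := by
  rcases p with i | j
  · obtain ⟨j, hj⟩ := hp
    have := Finset.single_le_sum (f := fun j => transferred M i j) (fun _ _ => Nat.zero_le _)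
      (Finset.mem_univ j)
    simpa [portTotal, transferred, hj] using this
  · obtain ⟨i, hi⟩ := hp
    have := Finset.single_le_sum (f := fun i => transferred M i j) (fun _ _ => Nat.zero_le _)
      (Finset.mem_univ i)
    simpa [portTotal, transferred, hi] using this

/-- Conservation of packets at a port. -/
theorem portTotal_queue_add_departures {Ω : Type*} {N₁ N₂ : ℕ} {A : ℕ → Ω → Packets N₁ N₂}
    {π : Policy Ω N₁ N₂} {ω : Ω}
    (hπ : ∀ n, IsSwitchMatching (queue A π n ω) (schedule A π n ω)) (p : Port N₁ N₂) (n : ℕ) :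
    portTotal (queue A π n ω) p + departures A π p n ω = arrivals A p n ω := by
  induction n with
  | zero => rcases p with i | j <;> simp [portTotal, queue, departures, arrivals]
  | succ n ih =>
    have h1 : portTotal (queue A π (n + 1) ω) p + portTotal (transferred (schedule A π n ω)) p =
        portTotal (queue A π n ω) p + portTotal (A n ω) p := by
      rw [← portTotal_add, ← portTotal_add]
      congr 1
      funext i j
      have := (hπ n).transferred_le i j
      simp only [queue]
      unfold schedule at this ⊢
      omega
    simp only [departures, arrivals, Finset.sum_range_succ] at ih ⊢
    omega

/-! ### Sublinear queue growth on a sample path -/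

/-- If the arrivals `a p` have rates below one, and `p` is served at unit rate whenever its queue
`q p` is within the fraction `1 / N` of the longest queue, then all queues grow sublinearly. Here
`d p` counts the departures. -/
theorem exists_le_mul_add_of_served {ι : Type*} [Finite ι] (N : ℕ) (q a d : ι → ℕ → ℕ)
    (rate : ι → ℝ) (hcons : ∀ p n, q p n + d p n = a p n)
    (hmono : ∀ p, Monotone (a p))
    (ha : ∀ p, Tendsto (fun n : ℕ => (a p n : ℝ) / n) atTop (𝓝 (rate p)))
    (hrate : ∀ p, rate p < 1) (hd : ∀ p n, d p n ≤ d p (n + 1) ∧ d p (n + 1) ≤ d p n + 1)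
    (hserve : ∀ n D p, (∀ p', q p' n ≤ D) → N * D < N * q p n + D → d p n + 1 ≤ d p (n + 1))
    {ε : ℝ} (hε : 0 < ε) : ∃ C : ℕ, ∀ n p, (q p n : ℝ) ≤ ε * n + C := by
  cases nonempty_fintype ι
  rcases isEmpty_or_nonempty ι with hι | hι
  · exact ⟨0, fun _ p => hι.elim p⟩
  -- The window will have length `k = n / K`, so that `4 (N + 1) k ≤ ε n`.
  obtain ⟨K, hK⟩ := exists_nat_gt (max 1 (4 * (N + 1) / ε))
  have hK1 : (1 : ℝ) < K := (le_max_left _ _).trans_lt hK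
  have hKε : 4 * (N + 1) < ε * K := by
    have := (le_max_right _ _).trans_lt hK
    rw [div_lt_iff₀ hε] at this
    linarith
  have hK0 : 0 < K := by
    have : (0 : ℝ) < K := by linarith
    exact_mod_cast this
  obtain ⟨c, hc0, hc1, hc⟩ : ∃ c : ℝ, 0 < c ∧ c ≤ 1 ∧ ∀ p, c ≤ 1 - rate p := by
    obtain ⟨p₀, hp₀⟩ := Finite.exists_max rate
    exact ⟨min 1 (1 - rate p₀), lt_min one_pos (by linarith [hrate p₀]), min_le_left _ _,
      fun p => (min_le_right _ _).trans (by linarith [hp₀ p])⟩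
  -- With `n ≤ 2 k K`, the arrival error `2 δ n` over a window is at most `c k`, the slack in the
  -- service capacity.
  set δ : ℝ := c / (4 * K) with hδ
  have hδ0 : 0 < δ := by positivity
  have hδK : δ * K = c / 4 := by
    rw [hδ]
    field_simp
  have hev : ∀ᶠ n : ℕ in atTop, ∀ p, |(a p n : ℝ) - rate p * n| ≤ δ * n := by
    refine eventually_all.2 fun p => ?_
    filter_upwards [Metric.tendsto_nhds.1 (ha p) δ hδ0, eventually_gt_atTop 0] with n hn hn0
    have hn0 : (0 : ℝ) < n := by exact_mod_cast hn0
    rw [Real.dist_eq] at hn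
    have h1 : (a p n : ℝ) - rate p * n = ((a p n : ℝ) / n - rate p) * n := by field_simp
    rw [h1, abs_mul, abs_of_pos hn0]
    exact mul_le_mul_of_nonneg_right hn.le hn0.le
  obtain ⟨n₀, hn₀⟩ := eventually_atTop.1 hev
  have hlip : ∀ p m k, d p (m + k) ≤ d p m + k := fun p m k => by
    induction k with
    | zero => simp
    | succ k ih =>
      have := (hd p (m + k)).2
      rw [← add_assoc]
      omega
  -- From `n₁` on, windows are nonempty and, as `k ≤ n / 2`, start no earlier than `n₀`.
  set n₁ := max (2 * n₀) (2 * K) with hn₁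
  refine ⟨∑ m ∈ Finset.range n₁, ∑ p, q p m, fun n => ?_⟩
  set C := ∑ m ∈ Finset.range n₁, ∑ p, q p m with hC
  induction n using Nat.strong_induction_on with
  | _ n ih =>
  rcases lt_or_ge n n₁ with hn | hn
  · intro p
    have h1 : q p n ≤ ∑ p, q p n :=
      Finset.single_le_sum (f := fun p => q p n) (fun _ _ => Nat.zero_le _) (Finset.mem_univ p)
    have h2 : ∑ p, q p n ≤ C :=
      Finset.single_le_sum (f := fun m => ∑ p, q p m) (fun _ _ => Nat.zero_le _)
        (Finset.mem_range.2 hn)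
    have h3 : (q p n : ℝ) ≤ C := by exact_mod_cast h1.trans h2
    have : 0 ≤ ε * n := by positivity
    linarith
  obtain ⟨p, hp⟩ := Finite.exists_max fun p => q p n
  suffices hmain : (q p n : ℝ) ≤ ε * n + C from fun p' =>
    (Nat.cast_le.2 (hp p')).trans hmain
  by_contra! hbig
  have hn2 : 2 * n₀ ≤ n := (le_max_left _ _).trans hn
  have hnK : 2 * K ≤ n := (le_max_right _ _).trans hn
  have hk1 : n / K * K ≤ n := Nat.div_mul_le_self n K
  have hk2 : n < (n / K + 1) * K := Nat.lt_mul_of_div_lt (Nat.lt_succ_self _) hK0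
  set k := n / K with hk
  have hK2 : 2 ≤ K := by exact_mod_cast hK1
  have hk2n : k * 2 ≤ n := (Nat.mul_le_mul_left k hK2).trans hk1
  have hkpos : 0 < k := Nat.div_pos (by omega) hK0
  have hkn : k ≤ n := by omega
  have hnK' : n ≤ 2 * (k * K) := by nlinarith
  have hn0 : (0 : ℝ) ≤ n := Nat.cast_nonneg n
  have hkR : (k : ℝ) * K ≤ n := by exact_mod_cast hk1
  have hkR' : (n : ℝ) ≤ 2 * (k * K) := by exact_mod_cast hnK'
  have hδn : 2 * δ * n ≤ c * k := by
    have : 2 * δ * n ≤ 2 * δ * (2 * (k * K)) := by gcongr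
    nlinarith
  have harr : ∀ m, n₀ ≤ m → m ≤ n →
      (a p n : ℝ) - a p m ≤ rate p * ((n : ℝ) - m) + 2 * δ * n := fun m hm hmn => by
    have h1 := abs_le.1 (hn₀ m hm p)
    have h2 := abs_le.1 (hn₀ n (by omega) p)
    have h3 : δ * m ≤ δ * n := by gcongr
    linarith [h1.1, h2.2]
  have hcR : ∀ m, (q p m : ℝ) + d p m = a p m := fun m => by exact_mod_cast hcons p m
  have hserved : ∀ m, n - k ≤ m → m < n → d p m + 1 ≤ d p (m + 1) := fun m hm hmn => by
    -- Departures are at most one per slot, so no queue in the window exceeds `q p n + k`. The queue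
    -- of `p` is at least `q p n - 2 k`, and `q p n > ε n` makes this near-maximal.
    refine hserve m (q p n + k) p (fun p' => ?_) ?_
    · have h1 := hcons p' m
      have h2 := hcons p' n
      have h3 := hlip p' m (n - m)
      rw [Nat.add_sub_cancel' hmn.le] at h3
      have h4 := hmono p' hmn.le
      have h5 := hp p'
      omega
    · have h1 := harr m (by omega) hmn.le
      have h2 : (d p m : ℝ) ≤ d p n := by
        exact_mod_cast monotone_nat_of_le_succ (fun n => (hd p n).1) hmn.le
      have h3 := hcR n
      have h4 := hcR m
      have h5 : (n : ℝ) - m ≤ k := by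
        have : n ≤ m + k := by omega
        have : (n : ℝ) ≤ m + k := by exact_mod_cast this
        linarith
      have h6 : rate p * ((n : ℝ) - m) ≤ k := by
        have h0 : (0 : ℝ) ≤ n - m := sub_nonneg.2 (Nat.cast_le.2 hmn.le)
        nlinarith [hrate p]
      have h7 : c * k ≤ k := mul_le_of_le_one_left (Nat.cast_nonneg k) hc1
      have h8 : (q p n : ℝ) - 2 * k ≤ q p m := by linarith
      have h9 : 4 * (N + 1) * (k : ℝ) ≤ ε * n :=
        calc 4 * (N + 1) * (k : ℝ) ≤ ε * K * k := by gcongr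
          _ = ε * (k * K) := by ring
          _ ≤ ε * n := by gcongr
      have h10 : (N : ℝ) * (q p n - 2 * k) ≤ N * q p m := by gcongr
      have hC0 : (0 : ℝ) ≤ C := Nat.cast_nonneg C
      have hk0 : (0 : ℝ) ≤ k := Nat.cast_nonneg k
      have hNk : (0 : ℝ) ≤ N * k := by positivity
      have : (N : ℝ) * (q p n + k) < N * q p m + (q p n + k) := by linarith
      exact_mod_cast this
  have htotal : ∀ t, t ≤ k → d p (n - k) + t ≤ d p (n - k + t) := fun t ht => by
    induction t with
    | zero => simp
    | succ t iht =>
      have := hserved (n - k + t) (by omega) (by omega)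
      have := iht (by omega)
      rw [← add_assoc, ← add_assoc]
      omega
  -- Over the window `p` has at least `k` departures and at most `(1 - c) k + c k` arrivals, so `q p
  -- n ≤ q p (n - k)`, against the induction hypothesis.
  have hfin := htotal k le_rfl
  rw [Nat.sub_add_cancel hkn] at hfin
  have hfinR : (d p (n - k) : ℝ) + k ≤ d p n := by exact_mod_cast hfin
  have h1 := harr (n - k) (by omega) (Nat.sub_le _ _)
  have h2 := ih (n - k) (by omega) p
  have h3 := hcR n
  have h4 := hcR (n - k)
  have h5 := hc p
  rw [Nat.cast_sub hkn] at h1 h2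
  have h6 : 0 ≤ ε * k := by positivity
  have h7 : c * k ≤ (1 - rate p) * k := by gcongr
  linarith

/-! ### Rate stability -/

theorem mainTheorem1 {N₁ N₂ : ℕ} {Ω : Type*} [MeasurableSpace Ω]
    (P : Measure Ω) [IsProbabilityMeasure P]
    (A : ℕ → Ω → Packets N₁ N₂) (rate : Port N₁ N₂ → ℝ)
    (hSLLN : SatisfiesSLLN P A rate) (hrate : ∀ p, rate p < 1)
    (π : Policy Ω N₁ N₂) (hπ : IsLHPFPolicy A π) :
    RateStable P A π rate := by
  filter_upwards [hSLLN] with ω hω p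
  have hcons := portTotal_queue_add_departures fun n => (hπ n ω).1
  have hq : Tendsto (fun n : ℕ => (portTotal (queue A π n ω) p : ℝ) / n) atTop (𝓝 0) := by
    refine Metric.tendsto_nhds.2 fun ε hε => ?_
    obtain ⟨C, hC⟩ := exists_le_mul_add_of_served (N₁ + N₂)
      (fun p n => portTotal (queue A π n ω) p) (fun p n => arrivals A p n ω)
      (fun p n => departures A π p n ω) rate hcons
      (fun p => monotone_nat_of_le_succ fun n => by simp [arrivals, Finset.sum_range_succ])
      hω hrate
      (fun p n => by
        have := (hπ n ω).1.portTotal_transferred_le_one p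
        simpa [departures, Finset.sum_range_succ] using this)
      (fun n D p hD hp => by
        have := ((hπ n ω).matchesPort hD hp).one_le_portTotal_transferred
        simpa [departures, Finset.sum_range_succ] using this)
      (half_pos hε)
    filter_upwards [eventually_gt_atTop 0,
      tendsto_natCast_atTop_atTop.eventually_gt_atTop (C / (ε / 2))] with n hn hnC
    have hn : (0 : ℝ) < n := by exact_mod_cast hn
    rw [Real.dist_eq, sub_zero, abs_of_nonneg (by positivity), div_lt_iff₀ hn]
    rw [div_lt_iff₀ (half_pos hε)] at hnC
    linarith [hC n p]
  have := (hω p).sub hq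
  rw [sub_zero] at this
  refine this.congr fun n => ?_
  rw [← sub_div, ← hcons p n]
  push_cast
  ring
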